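/- Let $\mathbb K$ be a field, let $\pi:E\to S^1$ be a fiber bundle with typical fiber $E_0$, and let $E'\subset E$ and $E_0'\subset E_0$ be subsets (with the subspace topologies) such that for every $p\in S^1$ there is a trivialization $$\phi_p:\pi^{-1}(S^1\setminus\{p\})\to (S^1\setminus\{p\})\times E_0$$ (a homeomorphism commuting with the projections to $S^1\setminus\{p\}$) whose restriction to $\pi^{-1}(S^1\setminus\{p\})\cap E'$ is a homeomorphism onto $(S^1\setminus\{p\})\times E_0'$. Let $H_k(X,A;\mathbb K)$ denote relative singular homology with coefficients in $\mathbb K$, with $H_{-1}=0$. Then for all $k\ge 0$ $$\dim H_k(E,E';\mathbb K)\le \dim H_k(E_0,E_0';\mathbb K)+\dim H_{k-1}(E_0,E_0';\mathbb K),$$ where dimensions may be infinite (the inequality holds for cardinals). -/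

import Mathlib

open CategoryTheory AlgebraicTopology

universe u

noncomputable section

/-- The inclusion `A ⟶ X` of a subset `A` of a topological space `X` (with the subspace topology). -/
def subspaceInclusion {X : Type u} [TopologicalSpace X] (A : Set X) :
    TopCat.of A ⟶ TopCat.of X :=
  TopCat.ofHom ⟨Subtype.val, continuous_subtype_val⟩

/-- The relative singular chain complex `C(X, A; K) = C(X; K) / C(A; K)`: the cokernel of the map of
singular chain complexes induced by the inclusion of `A` in `X`. -/
def relSingularChainComplex (K : Type u) [Field K] (X : Type u) [TopologicalSpace X] (A : Set X) :
    ChainComplex (ModuleCat.{u} K) ℕ :=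
  Limits.cokernel
    (((singularChainComplexFunctor (ModuleCat.{u} K)).obj (ModuleCat.of K K)).map
      (subspaceInclusion A))

/-- The `k`-th relative singular homology `H_k(X, A; K)`, a `K`-vector space. -/
def relSingularHomology (K : Type u) [Field K] (X : Type u) [TopologicalSpace X] (A : Set X)
    (k : ℕ) : ModuleCat.{u} K :=
  (relSingularChainComplex K X A).homology k

/-- `π : E → B` is a (locally trivial) fiber bundle with typical fiber `F`. -/
def IsFiberBundleWithFiber (F : Type*) [TopologicalSpace F] {B E : Type*} [TopologicalSpace B]
    [TopologicalSpace E] (π : E → B) : Prop :=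
  ∀ b : B, ∃ φ : Bundle.Trivialization F π, b ∈ φ.baseSet

end

/-! Pull the pair back along `ℝ → S¹` to an infinite cyclic cover `(Z, Z')` of `(E, E')` with deck
transformation `T`. Simplices are contractible, so those of `Z` over a given simplex of `E` form one
free `ℤ`-orbit. Hence `0 → C(Z) → C(Z) → C(E) → 0`, with first map `1 - T`, is exact; likewise for
`Z'` and, by the snake lemma, for the relative chains (`shortExact_cokernel`). The long exact
sequence bounds `dim H_k(E, E')` by `dim H_k(Z, Z') + dim H_{k-1}(Z, Z')`.

Over `ℝ` the transition maps can be absorbed one interval at a time, with no monodromy left. So `(Z,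
Z')` is `ℝ × (E₀, E₀')` (`exists_homeomorph_real_prod`), which has the homology of `(E₀, E₀')`. -/

/-! ### Chains of a free `ℤ`-cover -/

/-- A sequence in a group indexed by `ℤ` has a primitive. -/
lemma exists_int_primitive {G : Type*} [Group G] (x : ℤ → G) :
    ∃ w : ℤ → G, w 0 = 1 ∧ ∀ n, w (n + 1) = w n * x n := by
  let p : ℕ → G := fun n ↦ Nat.rec 1 (fun k g ↦ g * x k) n
  let q : ℕ → G := fun n ↦ Nat.rec (x (-1))⁻¹ (fun k g ↦ g * (x (Int.negSucc (k + 1)))⁻¹) n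
  refine ⟨fun n ↦ Int.rec p q n, rfl, ?_⟩
  rintro (n | n)
  · rfl
  · cases n with
    | zero =>
      change (1 : G) = (x (-1))⁻¹ * x (-1)
      simp
    | succ k =>
      change q k = q k * (x (Int.negSucc (k + 1)))⁻¹ * x (Int.negSucc (k + 1))
      simp

open Limits in
/-- The short complex of chains attached to a simplicial set `S` over `Q` with an endomorphism
`T` over `Q`. -/
noncomputable def deckShortComplex {C : Type*} [Category* C] [HasCoproducts.{u} C] [Preadditive C]
    (R : C) {S Q : SSet.{u}} (T : S ⟶ S) (q : S ⟶ Q) (hT : T ≫ q = q) :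
    ShortComplex (ChainComplex C ℕ) :=
  ShortComplex.mk (X₁ := S.chainComplex R) (X₂ := S.chainComplex R) (X₃ := Q.chainComplex R)
    (𝟙 _ - SSet.chainComplexMap T R) (SSet.chainComplexMap q R) (by
      rw [Preadditive.sub_comp, Category.id_comp, SSet.chainComplexMap, SSet.chainComplexMap,
        ← Functor.map_comp, hT, sub_self])

open Limits in
/-- If the simplices of `S` over a simplex of `Q` form a free `ℤ`-orbit under `T`, the chains of
`Q` are the coinvariants of the chains of `S`, and `1 - T` is injective on chains. -/
theorem deckShortComplex_shortExact {C : Type*} [Category* C] [HasCoproducts.{u} C] [Abelian C]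
    (R : C) {S Q : SSet.{u}} (T : S ⟶ S) (q : S ⟶ Q) (hT : T ≫ q = q)
    (h : ∀ n, ∃ e : Q.obj n × ℤ ≃ S.obj n, (∀ a m, q.app n (e (a, m)) = a) ∧
      ∀ a m, T.app n (e (a, m)) = e (a, m + 1)) :
    (deckShortComplex R T q hT).ShortExact := by
  apply HomologicalComplex.shortExact_of_degreewise_shortExact
  intro n
  obtain ⟨e, hq, he⟩ := h (.op (.mk n))
  -- Writing `e_m` for the summand at `(a, m)`, `w_m = -(e_0 + ⋯ + e_{m-1})` for `m ≥ 0`.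
  -- Telescoping makes `r : e_m ↦ w_m` a retraction of `1 - T`, and `(1 - T) w_m = e_m - e_0`.
  choose w hw₀ hw using fun a ↦ exists_int_primitive
    (G := Multiplicative (R ⟶ (S.chainComplex R).X n))
    (fun m ↦ .ofAdd (- S.ιChainComplex (e (a, m))))
  let r : (S.chainComplex R).X n ⟶ (S.chainComplex R).X n :=
    Cofan.IsColimit.desc (S.isColimitChainComplexXCofan R n)
      (fun σ ↦ (w (e.symm σ).1 (e.symm σ).2).toAdd)
  let s : (Q.chainComplex R).X n ⟶ (S.chainComplex R).X n :=
    Cofan.IsColimit.desc (Q.isColimitChainComplexXCofan R n)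
      (fun a ↦ S.ιChainComplex (e (a, 0)))
  have hr (a m) : S.ιChainComplex (e (a, m)) ≫ r = (w a m).toAdd := by
    refine (Cofan.IsColimit.fac (S.isColimitChainComplexXCofan R n)
      (fun σ ↦ (w (e.symm σ).1 (e.symm σ).2).toAdd) (e (a, m))).trans ?_
    rw [e.symm_apply_apply]
  have hs (a) : Q.ιChainComplex a ≫ s = S.ιChainComplex (e (a, 0)) :=
    Cofan.IsColimit.fac (Q.isColimitChainComplexXCofan R n) _ a
  have hw' (a m) : (w a (m + 1)).toAdd = (w a m).toAdd - S.ιChainComplex (e (a, m)) := by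
    rw [hw, toAdd_mul, toAdd_ofAdd, sub_eq_add_neg]
  let f : (S.chainComplex R).X n ⟶ (S.chainComplex R).X n := 𝟙 _ - (SSet.chainComplexMap T R).f n
  have hf (a m) : S.ιChainComplex (e (a, m)) ≫ f =
      S.ιChainComplex (e (a, m)) - S.ιChainComplex (e (a, m + 1)) := by
    rw [Preadditive.comp_sub, Category.comp_id, SSet.ι_chainComplexMap_f, he]
  have hg (a m) : S.ιChainComplex (e (a, m)) ≫ (SSet.chainComplexMap q R).f n =
      Q.ιChainComplex a := by
    rw [SSet.ι_chainComplexMap_f, hq]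
  have main (a m) : (w a m).toAdd ≫ f = S.ιChainComplex (e (a, m)) - S.ιChainComplex (e (a, 0)) := by
    induction m using Int.induction_on with
    | zero => rw [hw₀]; simp
    | succ i ih => rw [hw', Preadditive.sub_comp, ih, hf]; abel
    | pred i ih =>
      have := hw' a (-i - 1)
      rw [sub_add_cancel] at this
      rw [sub_eq_iff_eq_add.mp this.symm, Preadditive.add_comp, ih, hf, sub_add_cancel]
      abel
  refine (ShortComplex.Splitting.mk (S := (deckShortComplex R T q hT).map
    (HomologicalComplex.eval _ _ n)) r s ?_ ?_ ?_).shortExact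
  · change f ≫ r = 𝟙 _
    ext σ
    obtain ⟨⟨a, m⟩, rfl⟩ := e.surjective σ
    rw [← Category.assoc, hf, Preadditive.sub_comp, hr, hr, hw', Category.comp_id]
    abel
  · change s ≫ (SSet.chainComplexMap q R).f n = 𝟙 _
    ext a
    rw [← Category.assoc, hs, hg, Category.comp_id]
  · change r ≫ f + (SSet.chainComplexMap q R).f n ≫ s = 𝟙 _
    ext σ
    obtain ⟨⟨a, m⟩, rfl⟩ := e.surjective σ
    rw [Preadditive.comp_add, ← Category.assoc, ← Category.assoc, hr, hg, hs, main,
      Category.comp_id, sub_add_cancel]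

/-! ### Relative sequences and dimension counts -/

open Limits in
/-- The cokernels of a morphism of short exact sequences that is mono on the third terms form a
short exact sequence. -/
theorem shortExact_cokernel {C : Type*} [Category* C] [Abelian C] {S₁ S₂ : ShortComplex C}
    (φ : S₁ ⟶ S₂) (h₁ : S₁.ShortExact) (h₂ : S₂.ShortExact) [Mono φ.τ₃]
    {S₃ : ShortComplex C} (ψ : S₂ ⟶ S₃) (w : φ ≫ ψ = 0)
    (hψ : IsColimit (CokernelCofork.ofπ ψ w)) : S₃.ShortExact := by
  have := h₂.epi_g
  let D : ShortComplex.SnakeInput C :=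
    { L₀ := kernel φ, L₁ := S₁, L₂ := S₂, L₃ := S₃, v₀₁ := kernel.ι φ, v₁₂ := φ, v₂₃ := ψ
      w₀₂ := kernel.condition φ, w₁₃ := w, h₀ := kernelIsKernel φ, h₃ := hψ
      L₁_exact := h₁.exact, L₂_exact := h₂.exact, epi_L₁_g := h₁.epi_g, mono_L₂_f := h₂.mono_f }
  have h0 : D.v₀₁.τ₃ = 0 := by
    rw [← cancel_mono φ.τ₃, zero_comp]
    exact D.w₀₂_τ₃
  have hm : Mono D.v₀₁.τ₃ := mono_of_isLimit_fork D.h₀τ₃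
  -- The snake sequence is exact at `S₃.X₁`, so a vanishing kernel of `φ.τ₃` makes `S₃.f` mono.
  have hz : IsZero D.L₀.X₃ := by
    rw [IsZero.iff_id_eq_zero, ← cancel_mono D.v₀₁.τ₃, h0, comp_zero, comp_zero]
  have hmono : Mono S₃.f := (D.L₂'_exact.mono_g_iff.mpr (hz.eq_zero_of_src _))
  have hepi : Epi S₃.g := by
    have : Epi ψ.τ₃ := epi_of_isColimit_cofork D.h₃τ₃
    have : Epi (S₂.g ≫ ψ.τ₃) := epi_comp _ _
    rw [← ψ.comm₂₃] at this
    exact epi_of_epi ψ.τ₂ _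
  exact { exact := D.L₃_exact }

theorem rank_le_of_exact {K : Type u} [Field K] (S : ShortComplex (ModuleCat.{u} K))
    (h : S.Exact) : Module.rank K S.X₂ ≤ Module.rank K S.X₁ + Module.rank K S.X₃ := by
  rw [← S.g.hom.rank_range_add_rank_ker, add_comm]
  refine add_le_add ?_ (Submodule.rank_le _)
  rw [← h.moduleCat_range_eq_ker]
  exact rank_range_le _

/-- Both bounds come from the long exact sequence. Nothing lies below degree `0`, so there `S.g` is
surjective on homology. -/
theorem rank_homology_le_of_shortExact {K : Type u} [Field K]
    {S : ShortComplex (ChainComplex (ModuleCat.{u} K) ℕ)} (h : S.ShortExact) :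
    Module.rank K (S.X₃.homology 0) ≤ Module.rank K (S.X₂.homology 0) ∧
      ∀ k, Module.rank K (S.X₃.homology (k + 1)) ≤
        Module.rank K (S.X₂.homology (k + 1)) + Module.rank K (S.X₁.homology k) := by
  refine ⟨?_, fun k ↦ rank_le_of_exact _ (h.homology_exact₃ (k + 1) k rfl)⟩
  have := h.epi_g
  have : Epi (HomologicalComplex.homologyMap S.g 0) := by
    exact HomologicalComplex.epi_homologyMap_of_epi_of_not_rel _ _ (by simp)
  rw [← rank_range_of_surjective _ ((ModuleCat.epi_iff_surjective _).mp this)]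
  exact rank_range_le _

/-! ### Lifting simplices through `ℝ → S¹` -/

lemma exists_real_lift_of_contractible {A : Type*} [TopologicalSpace A] [ContractibleSpace A]
    (a : C(A, Circle)) : ∃ τ : C(A, ℝ), ∀ x, Circle.exp (τ x) = a x := by
  obtain ⟨x₀, ⟨H⟩⟩ := id_nullhomotopic A
  obtain ⟨s, hs⟩ := Circle.exp_surjective (a x₀)
  let G : C(unitInterval × A, Circle) := a.comp H.symm.toContinuousMap
  have h0 : ∀ x, G (0, x) = Circle.exp ((ContinuousMap.const A s) x) := fun x ↦ by
    have : H.symm (0, x) = x₀ := H.symm.apply_zero x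
    simp [G, hs]
  -- The reversed contraction joins a constant map, which lifts to `s`, to `a`; the lifted homotopy
  -- at time `1` lifts `a`.
  let L := Circle.isCoveringMap_exp.liftHomotopy G (.const A s) h0
  refine ⟨L.comp ⟨fun x ↦ (1, x), by fun_prop⟩, fun x ↦ ?_⟩
  refine (congr_fun (Circle.isCoveringMap_exp.liftHomotopy_lifts G (.const A s) h0) (1, x)).trans ?_
  simp [G]

/-- Uniqueness of lifts to a covering: on a connected space, agreement at one point suffices. -/
lemma exists_int_of_exp_comp_eq {A : Type*} [TopologicalSpace A] [ConnectedSpace A]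
    (σ τ : C(A, ℝ)) (h : ∀ x, Circle.exp (σ x) = Circle.exp (τ x)) :
    ∃ m : ℤ, ∀ x, σ x = τ x + m * (2 * Real.pi) := by
  obtain ⟨x₀⟩ := (inferInstance : Nonempty A)
  obtain ⟨m, hm⟩ := Circle.exp_eq_exp.mp (h x₀)
  refine ⟨m, congr_fun (Circle.isCoveringMap_exp.eq_of_comp_eq σ.continuous (by fun_prop) ?_ x₀ hm)⟩
  ext1 x
  simp only [Function.comp_apply, h]
  exact Circle.exp_eq_exp.mpr ⟨-m, by push_cast; ring⟩

/-- If `B` is the pullback of `π : E → Circle` along `Circle.exp`, the maps from a contractible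
space to `B` over a given map to `E` form a free orbit of the deck transformation. -/
theorem exists_equiv_continuousMap_pullback {A B E : Type*} [TopologicalSpace A]
    [TopologicalSpace B] [TopologicalSpace E] [ContractibleSpace A] (π : C(E, Circle))
    (t : C(B, ℝ)) (q : C(B, E)) (T : C(B, B))
    (hemb : Topology.IsEmbedding fun b ↦ (t b, q b))
    (hrange : ∀ s x, Circle.exp s = π x ↔ ∃ b, t b = s ∧ q b = x)
    (hT : ∀ b, t (T b) = t b + 2 * Real.pi) (hq : ∀ b, q (T b) = q b) :
    ∃ e : C(A, E) × ℤ ≃ C(A, B), (∀ a m, q.comp (e (a, m)) = a) ∧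
      ∀ a m, T.comp (e (a, m)) = e (a, m + 1) := by
  have hext {b b' : B} (h₁ : t b = t b') (h₂ : q b = q b') : b = b' :=
    hemb.injective (Prod.ext h₁ h₂)
  have hlift (a : C(A, E)) (τ : C(A, ℝ)) (h : ∀ x, Circle.exp (τ x) = π (a x)) :
      ∃ b : C(A, B), (∀ x, t (b x) = τ x) ∧ ∀ x, q (b x) = a x := by
    choose b hb₁ hb₂ using fun x ↦ (hrange _ _).mp (h x)
    refine ⟨⟨b, hemb.continuous_iff.mpr ?_⟩, hb₁, hb₂⟩
    have : ((fun b ↦ (t b, q b)) ∘ b) = fun x ↦ (τ x, a x) := by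
      ext1 x
      simp [hb₁, hb₂]
    rw [this]
    fun_prop
  choose τ hτ using fun a : C(A, E) ↦ exists_real_lift_of_contractible (π.comp a)
  choose L hL₁ hL₂ using fun (z : C(A, E) × ℤ) ↦
    hlift z.1 ⟨fun x ↦ τ z.1 x + z.2 * (2 * Real.pi), by fun_prop⟩ (fun x ↦ by
      refine Eq.trans ?_ (hτ z.1 x)
      exact Circle.exp_eq_exp.mpr ⟨z.2, rfl⟩)
  simp only [ContinuousMap.coe_mk] at hL₁
  obtain ⟨x₀⟩ := (inferInstance : Nonempty A)
  refine ⟨Equiv.ofBijective L ⟨?_, ?_⟩, fun a m ↦ ContinuousMap.ext (hL₂ (a, m)),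
    fun a m ↦ ContinuousMap.ext fun x ↦ hext ?_ ?_⟩
  · rintro ⟨a, m⟩ ⟨a', m'⟩ h
    have ha : a = a' := ContinuousMap.ext fun x ↦ by
      rw [← hL₂ (a, m), ← hL₂ (a', m'), h]
    subst ha
    have := hL₁ (a, m) x₀
    rw [h, hL₁] at this
    have h2 : (m' : ℝ) = m := by
      apply mul_right_cancel₀ Real.two_pi_pos.ne'
      simpa using this
    rw [Int.cast_injective h2]
  · intro b
    obtain ⟨m, hm⟩ := exists_int_of_exp_comp_eq (t.comp b) (τ (q.comp b)) (fun x ↦ by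
      rw [hτ]
      exact (hrange _ _).mpr ⟨b x, rfl, rfl⟩)
    refine ⟨(q.comp b, m), ContinuousMap.ext fun x ↦ hext ?_ ?_⟩
    · rw [hL₁, ← hm]; rfl
    · rw [hL₂]; rfl
  · change t (T (L (a, m) x)) = t (L (a, m + 1) x)
    rw [hT, hL₁, hL₁]
    push_cast
    ring
  · change q (T (L (a, m) x)) = q (L (a, m + 1) x)
    rw [hq, hL₂, hL₂]

instance contractibleSpace_stdSimplex (n : ℕ) : ContractibleSpace (stdSimplex ℝ (Fin (n + 1))) :=
  (convex_stdSimplex ℝ _).contractibleSpace (Set.Nonempty.of_subtype)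

lemma toSSetObjEquiv_map {X Y : TopCat.{u}} (f : X ⟶ Y) (n : SimplexCategoryᵒᵖ)
    (σ : (TopCat.toSSet.obj X).obj n) :
    Y.toSSetObjEquiv n ((TopCat.toSSet.map f).app n σ) = f.hom.comp (X.toSSetObjEquiv n σ) :=
  rfl

/-- The short exact sequence of singular chains of the pullback of `π : E → Circle` along
`Circle.exp`. -/
theorem deckShortComplex_shortExact_of_pullback {C : Type*} [Category* C]
    [Limits.HasCoproducts.{u} C] [Abelian C] (R : C) {B E : Type u}
    [TopologicalSpace B] [TopologicalSpace E] (π : C(E, Circle))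
    (t : C(B, ℝ)) (q : C(B, E)) (T : C(B, B))
    (hemb : Topology.IsEmbedding fun b ↦ (t b, q b))
    (hrange : ∀ s x, Circle.exp s = π x ↔ ∃ b, t b = s ∧ q b = x)
    (hT : ∀ b, t (T b) = t b + 2 * Real.pi) (hq : q.comp T = q) :
    (deckShortComplex R (TopCat.toSSet.map (TopCat.ofHom T)) (TopCat.toSSet.map (TopCat.ofHom q))
      (by rw [← Functor.map_comp, ← TopCat.ofHom_comp, hq])).ShortExact := by
  refine deckShortComplex_shortExact R _ _ _ fun n ↦ ?_
  obtain ⟨e, h₁, h₂⟩ := exists_equiv_continuousMap_pullback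
    (A := stdSimplex ℝ (Fin (n.unop.len + 1))) π t q T hemb hrange hT (fun b ↦ congr($hq b))
  refine ⟨(((TopCat.of E).toSSetObjEquiv n).prodCongr (Equiv.refl ℤ)).trans
    (e.trans ((TopCat.of B).toSSetObjEquiv n).symm), fun a m ↦ ?_, fun a m ↦ ?_⟩
  · apply ((TopCat.of E).toSSetObjEquiv n).injective
    rw [toSSetObjEquiv_map]
    simpa using! h₁ ((TopCat.of E).toSSetObjEquiv n a) m
  · apply ((TopCat.of B).toSSetObjEquiv n).injective
    rw [toSSetObjEquiv_map]
    simpa using! h₂ ((TopCat.of E).toSSetObjEquiv n a) m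

/-! ### The infinite cyclic cover of the pair -/

/-- The pullback of a map `π : E → Circle` along `Circle.exp`. -/
abbrev CirclePullback {E : Type*} (π : E → Circle) : Type _ :=
  {z : ℝ × E // Circle.exp z.1 = π z.2}

namespace CirclePullback

variable {E : Type*} [TopologicalSpace E]

/-- The deck transformation of the pullback of `π : E → Circle` along `Circle.exp`. -/
noncomputable def deck (π : E → Circle) : C(CirclePullback π, CirclePullback π) where
  toFun z := ⟨(z.1.1 + 2 * Real.pi, z.1.2), by rw [Circle.periodic_exp]; exact z.2⟩

/-- The projection of the pullback to `E`. -/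
def proj (π : E → Circle) : C(CirclePullback π, E) where
  toFun z := z.1.2

/-- The projection of the pullback to `ℝ`. -/
def time (π : E → Circle) : C(CirclePullback π, ℝ) where
  toFun z := z.1.1

end CirclePullback

open CirclePullback Limits in
/-- The homology of a pair over the circle is bounded by that of its pullback to the real line. -/
theorem rank_relSingularHomology_le_of_circlePullback (K : Type u) [Field K] {E : Type u}
    [TopologicalSpace E] (π : C(E, Circle)) (E' : Set E) :
    Module.rank K (relSingularHomology K E E' 0) ≤
        Module.rank K (relSingularHomology K (CirclePullback π) (proj π ⁻¹' E') 0) ∧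
      ∀ k : ℕ, Module.rank K (relSingularHomology K E E' (k + 1)) ≤
        Module.rank K (relSingularHomology K (CirclePullback π) (proj π ⁻¹' E') (k + 1)) +
          Module.rank K (relSingularHomology K (CirclePullback π) (proj π ⁻¹' E') k) := by
  let R := ModuleCat.of K K
  let Z' := proj π ⁻¹' E'
  let t' : C(Z', ℝ) := (time π).comp ⟨Subtype.val, continuous_subtype_val⟩
  let q' : C(Z', E') := ⟨fun z ↦ ⟨proj π z.1, z.2⟩, by fun_prop⟩
  let T' : C(Z', Z') := ⟨fun z ↦ ⟨deck π z.1, z.2⟩, by fun_prop⟩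
  have h₂ := deckShortComplex_shortExact_of_pullback R π (time π) (proj π) (deck π)
    Topology.IsEmbedding.subtypeVal
    (fun s x ↦ ⟨fun h ↦ ⟨⟨(s, x), h⟩, rfl, rfl⟩, by rintro ⟨b, rfl, rfl⟩; exact b.2⟩)
    (fun b ↦ rfl) rfl
  -- `Z'` is a subset of the cover rather than literally a `CirclePullback`; it is the pullback of
  -- `π` restricted to `E'` up to homeomorphism.
  have h₁ := deckShortComplex_shortExact_of_pullback R
    (π.comp ⟨Subtype.val, continuous_subtype_val⟩) t' q' T'
    (Topology.IsEmbedding.of_comp (g := Prod.map id Subtype.val) (by fun_prop) (by fun_prop)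
      (Topology.IsEmbedding.subtypeVal.comp Topology.IsEmbedding.subtypeVal))
    (fun s x ↦ ⟨fun h ↦ ⟨⟨⟨(s, x), h⟩, x.2⟩, rfl, rfl⟩, by rintro ⟨b, rfl, rfl⟩; exact b.1.2⟩)
    (fun b ↦ rfl) rfl
  let F := (singularChainComplexFunctor (ModuleCat.{u} K)).obj R
  have hdeck {X Y : TopCat.{u}} (f : X ⟶ Y) (a : X ⟶ X) (b : Y ⟶ Y) (h : f ≫ b = a ≫ f) :
      F.map f ≫ (𝟙 (F.obj Y) - F.map b) = (𝟙 (F.obj X) - F.map a) ≫ F.map f := by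
    rw [Preadditive.comp_sub, Preadditive.sub_comp, ← F.map_comp, ← F.map_comp, h,
      Category.comp_id, Category.id_comp]
  have hproj {X Y X' Y' : TopCat.{u}} (f : X ⟶ Y) (a : X ⟶ X') (b : Y ⟶ Y') (f' : X' ⟶ Y')
      (h : f ≫ b = a ≫ f') : F.map f ≫ F.map b = F.map a ≫ F.map f' := by
    rw [← F.map_comp, ← F.map_comp, h]
  have hmono {X : Type u} [TopologicalSpace X] (A : Set X) : Mono (F.map (subspaceInclusion A)) := by
    have : Mono (subspaceInclusion A) :=
      (TopCat.mono_iff_injective _).mpr Subtype.val_injective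
    infer_instance
  have hT₁ : TopCat.toSSet.map (TopCat.ofHom T') ≫ TopCat.toSSet.map (TopCat.ofHom q') =
    TopCat.toSSet.map (TopCat.ofHom q') := rfl
  have hT₂ : TopCat.toSSet.map (TopCat.ofHom (deck π)) ≫ TopCat.toSSet.map (TopCat.ofHom (proj π)) =
    TopCat.toSSet.map (TopCat.ofHom (proj π)) := rfl
  let φ : deckShortComplex R _ _ hT₁ ⟶ deckShortComplex R _ _ hT₂ :=
    { τ₁ := F.map (subspaceInclusion Z')
      τ₂ := F.map (subspaceInclusion Z')
      τ₃ := F.map (subspaceInclusion E')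
      comm₁₂ := hdeck (subspaceInclusion Z') (TopCat.ofHom T') (TopCat.ofHom (deck π)) rfl
      comm₂₃ := hproj (subspaceInclusion Z') (TopCat.ofHom q') (TopCat.ofHom (proj π))
        (subspaceInclusion E') rfl }
  have : Mono φ.τ₃ := hmono _
  have h₃ := shortExact_cokernel φ h₁ h₂ (cokernel.π φ) (cokernel.condition φ) (cokernelIsCokernel φ)
  have := rank_homology_le_of_shortExact h₃
  let e₁ : (cokernel φ).X₁ ≅ relSingularChainComplex K (CirclePullback π) Z' :=
    PreservesCokernel.iso ShortComplex.π₁ φ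
  let e₂ : (cokernel φ).X₂ ≅ relSingularChainComplex K (CirclePullback π) Z' :=
    PreservesCokernel.iso ShortComplex.π₂ φ
  let e₃ : (cokernel φ).X₃ ≅ relSingularChainComplex K E E' :=
    PreservesCokernel.iso ShortComplex.π₃ φ
  have hrank {X Y : ChainComplex (ModuleCat.{u} K) ℕ} (e : X ≅ Y) (k : ℕ) :
      Module.rank K (X.homology k) = Module.rank K (Y.homology k) :=
    (HomologicalComplex.homologyMapIso e k).toLinearEquiv.rank_eq
  simp only [hrank e₁, hrank e₂, hrank e₃] at this
  exact this

/-! ### Gluing trivializations over `ℝ` -/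

open Set in
/-- Trivializations of a pair over the intervals `[n, n + 1]` glue to one over the real line. -/
theorem exists_homeomorph_real_prod {Z F : Type*} [TopologicalSpace Z] [TopologicalSpace F]
    (p : C(Z, ℝ)) (A : ℤ → Z → F) (B : ∀ n : ℤ, Icc (n : ℝ) (n + 1) → F → Z)
    (hA : ∀ n : ℤ, ContinuousOn (A n) (p ⁻¹' Icc (n : ℝ) (n + 1)))
    (hB : ∀ n : ℤ, Continuous fun y : Icc (n : ℝ) (n + 1) × F ↦ B n y.1 y.2)
    (hpB : ∀ (n : ℤ) t x, p (B n t x) = t) (hAB : ∀ (n : ℤ) t x, A n (B n t x) = x)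
    (hBA : ∀ (n : ℤ) z (h : p z ∈ Icc (n : ℝ) (n + 1)), B n ⟨p z, h⟩ (A n z) = z)
    (Z' : Set Z) (F' : Set F)
    (hF : ∀ (n : ℤ) z, p z ∈ Icc (n : ℝ) (n + 1) → (z ∈ Z' ↔ A n z ∈ F')) :
    ∃ e : Z ≃ₜ ℝ × F, ∀ z, z ∈ Z' ↔ (e z).2 ∈ F' := by
  have hl (n : ℤ) : (↑(n + 1) : ℝ) ∈ Icc (↑(n + 1) : ℝ) (↑(n + 1) + 1) := by simp
  have hr (n : ℤ) : (↑(n + 1) : ℝ) ∈ Icc (n : ℝ) (n + 1) := by simp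
  have hAc (n : ℤ) (t : ℝ) (ht : t ∈ Icc (n : ℝ) (n + 1)) (g : F → Z) (hg : Continuous g)
      (hpg : ∀ x, p (g x) = t) : Continuous fun x ↦ A n (g x) :=
    (hA n).comp_continuous hg fun x ↦ by rw [mem_preimage, hpg]; exact ht
  have hBc (n : ℤ) (t : Icc (n : ℝ) (n + 1)) : Continuous (B n t) := (hB n).comp (.prodMk_right t)
  have hBA' (n : ℤ) (t : Icc (n : ℝ) (n + 1)) (z : Z) (h : p z = t) : B n t (A n z) = z := by
    obtain ⟨t, ht⟩ := t
    subst h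
    exact hBA n z ht
  -- The transition map at the common endpoint `n + 1`, from chart `n + 1` to chart `n`. Its
  -- primitive `c` corrects the charts so that neighbours agree.
  let θ (n : ℤ) : F ≃ₜ F :=
    { toFun x := A n (B (n + 1) ⟨_, hl n⟩ x)
      invFun x := A (n + 1) (B n ⟨_, hr n⟩ x)
      left_inv x := by dsimp only; rw [hBA' n ⟨_, hr n⟩ _ (hpB (n + 1) _ _), hAB]
      right_inv x := by dsimp only; rw [hBA' (n + 1) ⟨_, hl n⟩ _ (hpB n _ _), hAB]
      continuous_toFun := hAc n _ (hr n) _ (hBc _ _) (hpB _ _)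
      continuous_invFun := hAc (n + 1) _ (hl n) _ (hBc _ _) (hpB _ _) }
  have hθ (n : ℤ) (x : F) : x ∈ F' ↔ θ n x ∈ F' := by
    have h₁ := hF (n + 1) (B (n + 1) ⟨_, hl n⟩ x) (by rw [hpB]; exact hl n)
    have h₂ := hF n (B (n + 1) ⟨_, hl n⟩ x) (by rw [hpB]; exact hr n)
    rw [hAB] at h₁
    exact h₁.symm.trans h₂
  obtain ⟨c, hc₀, hc⟩ := exists_int_primitive θ
  have hc (n : ℤ) (x : F) : c (n + 1) x = c n (θ n x) := congr($(hc n) x)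
  have hcF (n : ℤ) : ∀ x : F, x ∈ F' ↔ c n x ∈ F' := by
    induction n using Int.induction_on with
    | zero => intro x; rw [hc₀]; rfl
    | succ i ih => intro x; rw [hc, ← ih, ← hθ]
    | pred i ih =>
      intro x
      obtain ⟨x, rfl⟩ := (θ (-i - 1)).surjective x
      rw [← hθ, ← hc, sub_add_cancel, ih]
  let r (z : Z) : F := c ⌊p z⌋ (A ⌊p z⌋ z)
  have hr' (n : ℤ) (z : Z) (h : p z ∈ Icc (n : ℝ) (n + 1)) : r z = c n (A n z) := by
    rcases h.2.lt_or_eq with h' | h'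
    · have : ⌊p z⌋ = n := Int.floor_eq_iff.mpr ⟨h.1, h'⟩
      simp only [r, this]
    -- At the right endpoint the floor jumps to `n + 1`, and `c (n + 1) = c n * θ n` reconciles the
    -- two charts.
    · have h' : p z = ↑(n + 1) := by push_cast; exact h'
      have : ⌊p z⌋ = n + 1 := by rw [h', Int.floor_intCast]
      simp only [r, this, hc]
      congr 1
      change A n (B (n + 1) ⟨_, hl n⟩ (A (n + 1) z)) = A n z
      rw [hBA' _ _ _ h']
  have hfl (t : ℝ) : t ∈ Icc (⌊t⌋ : ℝ) (⌊t⌋ + 1) := ⟨Int.floor_le t, (Int.lt_floor_add_one t).le⟩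
  have hB' (n : ℤ) (t : Icc (n : ℝ) (n + 1)) (x : F) : r (B n t ((c n).symm x)) = x := by
    rw [hr' n _ (by rw [hpB]; exact t.2), hAB, Homeomorph.apply_symm_apply]
  let e : Z ≃ ℝ × F :=
    { toFun z := (p z, r z)
      invFun y := B ⌊y.1⌋ ⟨y.1, hfl y.1⟩ ((c ⌊y.1⌋).symm y.2)
      left_inv z := by
        simp only [r, Homeomorph.symm_apply_apply]
        exact hBA _ _ _
      right_inv y := Prod.ext (hpB _ _ _) (hB' _ _ _) }
  have hlf : LocallyFinite fun n : ℤ ↦ Icc (n : ℝ) (n + 1) :=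
    locallyFinite_Icc_of_tendsto tendsto_intCast_atTop_atTop
      (Filter.tendsto_atBot_add_const_right _ _ (tendsto_intCast_atBot_iff.mpr Filter.tendsto_id))
  refine ⟨⟨e, ?_, ?_⟩, fun z ↦ (hF ⌊p z⌋ z (hfl _)).trans (hcF _ _)⟩
  · refine p.continuous.prodMk ?_
    refine (hlf.preimage_continuous p.continuous).continuous ?_
      (fun n ↦ isClosed_Icc.preimage p.continuous) fun n ↦ ?_
    · exact eq_univ_of_forall fun z ↦ mem_iUnion.mpr ⟨⌊p z⌋, hfl _⟩
    · exact ((c n).continuous.comp_continuousOn (hA n)).congr (hr' n)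
  · refine (hlf.preimage_continuous continuous_fst).continuous ?_
      (fun n ↦ isClosed_Icc.preimage continuous_fst) fun n ↦ ?_
    · exact eq_univ_of_forall fun y ↦ mem_iUnion.mpr ⟨⌊y.1⌋, hfl _⟩
    · rw [continuousOn_iff_continuous_domRestrict]
      have : (Prod.fst ⁻¹' Icc (n : ℝ) (n + 1)).domRestrict e.symm =
          fun y : (Prod.fst ⁻¹' Icc (n : ℝ) (n + 1) : Set (ℝ × F)) ↦
            B n ⟨y.1.1, y.2⟩ ((c n).symm y.1.2) := by
        ext1 y
        rw [domRestrict_apply, Equiv.symm_apply_eq]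
        exact (Prod.ext (hpB n ⟨y.1.1, y.2⟩ _) (hB' n ⟨y.1.1, y.2⟩ _)).symm
      exact this ▸ (hB n).comp (f := fun y : (Prod.fst ⁻¹' Icc (n : ℝ) (n + 1) : Set (ℝ × F)) ↦
        ((⟨y.1.1, y.2⟩ : Icc (n : ℝ) (n + 1)), (c n).symm y.1.2)) (by fun_prop)

/-! ### Homotopy invariance for pairs -/

open Limits in
/-- Mutually inverse maps up to homotopy induce quasi-isomorphisms on singular chains. -/
theorem quasiIso_singularChainComplexFunctor_map {C : Type*} [Category* C] [HasCoproducts.{u} C]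
    [Preadditive C] [CategoryWithHomology C] (R : C) {X Y : TopCat.{u}} (f : X ⟶ Y) (g : Y ⟶ X)
    (H₁ : TopCat.Homotopy (f ≫ g) (𝟙 X)) (H₂ : TopCat.Homotopy (g ≫ f) (𝟙 Y)) :
    QuasiIso (((singularChainComplexFunctor C).obj R).map f) := by
  let F := (singularChainComplexFunctor C).obj R
  let e : HomotopyEquiv (F.obj X) (F.obj Y) :=
    { hom := F.map f
      inv := F.map g
      homotopyHomInvId := (Homotopy.ofEq (F.map_comp f g).symm).trans
        ((H₁.singularChainComplexFunctorObjMap R).trans (Homotopy.ofEq (F.map_id X)))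
      homotopyInvHomId := (Homotopy.ofEq (F.map_comp g f).symm).trans
        ((H₂.singularChainComplexFunctorObjMap R).trans (Homotopy.ofEq (F.map_id Y))) }
  exact HomotopyEquiv.quasiIso_hom e

open Limits in
theorem quasiIso_singularChainComplexFunctor_map_of_homeomorph_real_prod {C : Type*} [Category* C]
    [HasCoproducts.{u} C] [Preadditive C] [CategoryWithHomology C] (R : C) {X Y : Type u}
    [TopologicalSpace X] [TopologicalSpace Y] (e : X ≃ₜ ℝ × Y) :
    QuasiIso (((singularChainComplexFunctor C).obj R).map
      (TopCat.ofHom ⟨fun x ↦ (e x).2, by fun_prop⟩ : TopCat.of X ⟶ TopCat.of Y)) := by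
  refine quasiIso_singularChainComplexFunctor_map R _
    (TopCat.ofHom ⟨fun y ↦ e.symm (0, y), by fun_prop⟩)
    -- Scaling the real coordinate contracts it to `0`; the other composite is already the identity.
    { toFun z := e.symm (z.1 * (e z.2).1, (e z.2).2)
      continuous_toFun := by fun_prop
      map_zero_left x := ?_
      map_one_left x := ?_ } 
    { toFun z := z.2
      map_zero_left y := ?_
      map_one_left y := ?_ }
  all_goals simp

open Limits in
/-- The relative homology of the product of a pair with the real line. -/
theorem rank_relSingularHomology_eq_of_homeomorph_real_prod (K : Type u) [Field K] {X Y : Type u}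
    [TopologicalSpace X] [TopologicalSpace Y] (e : X ≃ₜ ℝ × Y) (X' : Set X) (Y' : Set Y)
    (h : ∀ x, x ∈ X' ↔ (e x).2 ∈ Y') (k : ℕ) :
    Module.rank K (relSingularHomology K X X' k) =
      Module.rank K (relSingularHomology K Y Y' k) := by
  let e' : X' ≃ₜ ℝ × Y' :=
    { toFun x := ((e x).1, ⟨(e x).2, (h x).mp x.2⟩)
      invFun y := ⟨e.symm (y.1, y.2), (h _).mpr (by simp)⟩
      left_inv x := by simp
      right_inv y := by simp
      continuous_toFun := by fun_prop
      continuous_invFun := by fun_prop }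
  let F := (singularChainComplexFunctor (ModuleCat.{u} K)).obj (ModuleCat.of K K)
  let f : TopCat.of X ⟶ TopCat.of Y := TopCat.ofHom ⟨fun x ↦ (e x).2, by fun_prop⟩
  let f' : TopCat.of X' ⟶ TopCat.of Y' := TopCat.ofHom ⟨fun x ↦ (e' x).2, by fun_prop⟩
  have hf : QuasiIso (F.map f) :=
    quasiIso_singularChainComplexFunctor_map_of_homeomorph_real_prod _ e
  have hf' : QuasiIso (F.map f') :=
    quasiIso_singularChainComplexFunctor_map_of_homeomorph_real_prod _ e'
  have hmono {X : Type u} [TopologicalSpace X] (A : Set X) : Mono (F.map (subspaceInclusion A)) := by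
    have : Mono (subspaceInclusion A) :=
      (TopCat.mono_iff_injective _).mpr Subtype.val_injective
    infer_instance
  have hS {X : Type u} [TopologicalSpace X] (A : Set X) :
      (ShortComplex.mk (F.map (subspaceInclusion A)) _ (cokernel.condition _)).ShortExact :=
    have := hmono A
    { exact := ShortComplex.exact_cokernel _ }
  have hcomm : F.map (subspaceInclusion X') ≫ F.map f = F.map f' ≫ F.map (subspaceInclusion Y') := by
    rw [← F.map_comp, ← F.map_comp]
    rfl
  let φ : ShortComplex.mk (F.map (subspaceInclusion X')) _ (cokernel.condition _) ⟶
      ShortComplex.mk (F.map (subspaceInclusion Y')) _ (cokernel.condition _) :=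
    { τ₁ := F.map f'
      τ₂ := F.map f
      τ₃ := cokernel.map _ _ (F.map f') (F.map f) hcomm
      comm₁₂ := hcomm.symm
      comm₂₃ := by simp }
  -- Five lemma on the long exact sequences of the two pairs.
  have hφ : QuasiIso φ.τ₃ := HomologicalComplex.HomologySequence.quasiIso_τ₃ φ (hS X') (hS Y') hf' hf
  exact (isoOfQuasiIsoAt φ.τ₃ k).toLinearEquiv.rank_eq

/-! ### Pairs over the circle -/

lemma IsFiberBundleWithFiber.continuous {F B E : Type*} [TopologicalSpace F] [TopologicalSpace B]
    [TopologicalSpace E] {π : E → B} (h : IsFiberBundleWithFiber F π) : Continuous π :=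
  continuous_iff_continuousAt.mpr fun x ↦
    let ⟨φ, hφ⟩ := h (π x)
    φ.continuousAt_proj (φ.mem_source.mpr hφ)

open Set CirclePullback in
/-- A pair over the circle that is trivial over the complement of each point becomes trivial when
pulled back to the real line. -/
theorem exists_homeomorph_circlePullback {E E₀ : Type*} [TopologicalSpace E] [TopologicalSpace E₀]
    (π : E → Circle) (E' : Set E) (E₀' : Set E₀)
    (h : ∀ p : Circle, ∃ φ : Bundle.Trivialization E₀ π,
      φ.baseSet = {p}ᶜ ∧ φ '' (π ⁻¹' {p}ᶜ ∩ E') = {p}ᶜ ×ˢ E₀') :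
    ∃ e : CirclePullback π ≃ₜ ℝ × E₀, ∀ z, z ∈ proj π ⁻¹' E' ↔ (e z).2 ∈ E₀' := by
  choose φ hφ hφ' using h
  -- Rescaled by `π`, `[n, n + 1]` covers a half circle; `P n` is the antipode of its midpoint, so
  -- one trivialization covers it.
  let P (n : ℤ) : Circle := Circle.exp (n * Real.pi - Real.pi / 2)
  have hP (n : ℤ) (t : ℝ) (ht : t ∈ Icc (n : ℝ) (n + 1)) :
      Circle.exp (t * Real.pi) ∈ (φ (P n)).baseSet := by
    rw [hφ, mem_compl_singleton_iff]
    intro heq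
    obtain ⟨m, hm⟩ := Circle.exp_eq_exp.mp heq
    have hm' : t - n = 2 * m - 1 / 2 := by
      apply mul_right_cancel₀ Real.pi_ne_zero
      linear_combination hm
    have h₀ : (0 : ℝ) < m := by linarith [ht.1]
    have h₁ : (m : ℝ) < 1 := by linarith [ht.2]
    norm_cast at h₀ h₁
    omega
  have hbase (n : ℤ) (z : CirclePullback π) (hz : z.1.1 / Real.pi ∈ Icc (n : ℝ) (n + 1)) :
      π z.1.2 ∈ (φ (P n)).baseSet := by
    have := hP n _ hz
    rwa [div_mul_cancel₀ _ Real.pi_ne_zero, z.2] at this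
  refine exists_homeomorph_real_prod ⟨fun z ↦ z.1.1 / Real.pi, by fun_prop⟩
    (fun n z ↦ (φ (P n) z.1.2).2)
    (fun n t x ↦ ⟨(t * Real.pi, (φ (P n)).toOpenPartialHomeomorph.symm (Circle.exp (t * Real.pi), x)),
      ((φ (P n)).proj_symm_apply' (hP n t t.2)).symm⟩) ?_ ?_ ?_ ?_ ?_ _ _ ?_
  · intro n
    refine continuous_snd.comp_continuousOn ((φ (P n)).continuousOn_toFun.comp (by fun_prop) ?_)
    intro z hz
    exact (φ (P n)).mem_source.mpr (hbase n z hz)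
  · intro n
    refine Continuous.subtype_mk (Continuous.prodMk (by fun_prop) ?_) _
    refine (φ (P n)).continuousOn_invFun.comp_continuous (by fun_prop) fun y ↦ ?_
    exact (φ (P n)).mem_target.mpr (hP n _ y.1.2)
  · intro n t x
    exact mul_div_cancel_right₀ _ Real.pi_ne_zero
  · intro n t x
    exact congr_arg Prod.snd ((φ (P n)).apply_symm_apply' (hP n t t.2))
  · intro n z hz
    refine Subtype.ext (Prod.ext (div_mul_cancel₀ _ Real.pi_ne_zero) ?_)
    change (φ (P n)).toOpenPartialHomeomorph.symm (Circle.exp (z.1.1 / Real.pi * Real.pi), _) = _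
    rw [div_mul_cancel₀ _ Real.pi_ne_zero, z.2]
    exact (φ (P n)).symm_apply_mk_proj ((φ (P n)).mem_source.mpr (hbase n z hz))
  · intro n z hz
    have hb := hbase n z hz
    have hb' : π z.1.2 ∈ ({P n}ᶜ : Set Circle) := hφ (P n) ▸ hb
    have hs := (φ (P n)).mem_source.mpr hb
    constructor
    · intro hz'
      have : φ (P n) z.1.2 ∈ φ (P n) '' (π ⁻¹' {P n}ᶜ ∩ E') := mem_image_of_mem _ ⟨hb', hz'⟩
      rw [hφ'] at this
      exact this.2
    · intro hz'
      have : φ (P n) z.1.2 ∈ ({P n}ᶜ : Set Circle) ×ˢ E₀' :=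
        ⟨by rw [(φ (P n)).coe_fst hs]; exact hb', hz'⟩
      rw [← hφ'] at this
      obtain ⟨x, ⟨hx, hxE⟩, hxz⟩ := this
      have hxs : x ∈ (φ (P n)).source := (φ (P n)).mem_source.mpr (by rw [hφ]; exact hx)
      have hxz' : x = z.1.2 := (φ (P n)).injOn hxs hs hxz
      change z.1.2 ∈ E'
      exact hxz' ▸ hxE

/-- The bounds in degree `0` and in degrees `k + 1` are stated separately, as `H_{-1} = 0`;
dimensions are cardinals. -/
theorem mainTheorem11 (K : Type u) [Field K]
    (E E₀ : Type u) [TopologicalSpace E] [TopologicalSpace E₀]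
    (π : E → Circle) (hπ : IsFiberBundleWithFiber E₀ π)
    (E' : Set E) (E₀' : Set E₀)
    (h : ∀ p : Circle, ∃ φ : Bundle.Trivialization E₀ π,
      φ.baseSet = {p}ᶜ ∧ φ '' (π ⁻¹' {p}ᶜ ∩ E') = {p}ᶜ ×ˢ E₀') :
    Module.rank K (relSingularHomology K E E' 0) ≤
        Module.rank K (relSingularHomology K E₀ E₀' 0) ∧
      ∀ k : ℕ, Module.rank K (relSingularHomology K E E' (k + 1)) ≤
        Module.rank K (relSingularHomology K E₀ E₀' (k + 1)) +
          Module.rank K (relSingularHomology K E₀ E₀' k) := by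
  obtain ⟨e, he⟩ := exists_homeomorph_circlePullback π E' E₀' h
  have hrank := rank_relSingularHomology_eq_of_homeomorph_real_prod K e _ E₀' he
  obtain ⟨h₀, h₁⟩ := rank_relSingularHomology_le_of_circlePullback K ⟨π, hπ.continuous⟩ E'
  exact ⟨h₀.trans_eq (hrank 0), fun k ↦
    (h₁ k).trans_eq (congr_arg₂ (· + ·) (hrank (k + 1)) (hrank k))⟩
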